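/- Let $\sigma(t)=1/(1+e^{-t})$ and let $d\ge 2$. Given $R$ families of unit vectors $u_{j,\ell}\in\mathbb{R}^d$ and reals $h_{j,\ell}$ ($1\le j\le R$, $1\le \ell\le m_j$) and slopes $\kappa,\lambda>0$, put $$J_j(x)=\sum_{\ell=1}^{m_j}\sigma\big(\kappa(h_{j,\ell}-\langle u_{j,\ell},x\rangle)\big)-\big(m_j-\tfrac12\big),\qquad \Phi_{\kappa,\lambda}(x)=\sum_{j=1}^{R}\sigma(\lambda J_j(x)),\qquad \widehat C_{\kappa,\lambda}=\{x\in\mathbb{R}^d:\Phi_{\kappa,\lambda}(x)\ge\tfrac12\},$$ so that $\widehat C_{\kappa,\lambda}$ is the decision set of a two-layer sigmoidal MLP. For $\eta,\delta\in(0,\frac12)$ put $c_1=\log\frac{1-\eta}{\eta}$, $c_2=\log\frac{1-\delta}{\delta}$, and define the inner and outer bands $\mathcal B_{\rm in}=\bigcup_{j,\ell}\{x:|h_{j,\ell}-\langle u_{j,\ell},x\rangle|\le c_1/\kappa\}$ and $\mathcal B_{\rm out}=\bigcup_j\{x:|J_j(x)|\le c_2/\lambda\}$. Write $\mathcal N_t(S)=\{x:\operatorname{dist}(x,S)\le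 t\}$ and $d_{\mathrm H}$ for the Hausdorff distance. **Theorem.** There are constants $a,b>0$ depending only on $d$ with the following property. Let $C\subset\mathbb{R}^d$ be nonempty and compact and let $0<\varepsilon_{\rm cov}<\varepsilon$. Then there is a finite family of closed balls $\overline B(c_j,r_j)$, $r_j>0$, $1\le j\le R$, with $$C\subseteq\bigcup_j\overline B(c_j,r_j)\subseteq\mathcal N_{\varepsilon_{\rm cov}}(C),$$ such that for every $\varepsilon_{\rm poly}>0$ with $\varepsilon_{\rm poly}\le r_j$ for all $j$ and $\varepsilon_{\rm cov}+\varepsilon_{\rm poly}<\varepsilon$ there are polytopes $P_j=\{x:\langle u_{j,\ell},x\rangle\le h_{j,\ell},\ 1\le\ell\le m_j\}$ circumscribed about the balls (compact, with pairwise distinct outward unit normals $u_{j,1},\dots,u_{j,m_j}$ and $h_{j,\ell}=\langle u_{j,\ell},c_j\rangle+r_j$, hence with exactly $m_j$ facets) satisfying $$d_{\mathrm H}(P_j,\overline B(c_j,r_j))\le\varepsilon_{\rm poly},\qquad a\Big(\frac{r_j}{\varepsilon_{\rm poly}}\Big)^{\frac{d-1}{2}}\le m_j\le b\Big(\frac{r_j}{\varepsilon_{\rm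 poly}}\Big)^{\frac{d-1}{2}}\qquad(1\le j\le R),$$ and such that for all $0<\eta<\frac{1}{4\max_j m_j}$ and $0<\delta\le\frac1{4R}$ the following hold. 1. There are $\kappa_0,\lambda_0>0$ such that for all $\kappa\ge\kappa_0$ and $\lambda\ge\lambda_0$ the set $\widehat C_{\kappa,\lambda}$ is nonempty and compact and $$d_{\mathrm H}(\widehat C_{\kappa,\lambda},C)\le\varepsilon_{\rm cov}+\varepsilon_{\rm poly}+c_1\kappa^{-1}+c_2\lambda^{-1}\le\varepsilon.\qquad(*)$$ Moreover, in this range the bands have thickness $\Theta(\kappa^{-1})$ and $\Theta(\lambda^{-1})$. That is, there are $A_1,B_1>0$, independent of $\kappa$, with $$\mathcal N_{A_1/\kappa}(H)\subseteq\{x:|h_{j,\ell}-\langle u_{j,\ell},x\rangle|\le c_1/\kappa\}\subseteq\mathcal N_{B_1/\kappa}(H),\qquad H=\{x:\langle u_{j,\ell},x\rangle=h_{j,\ell}\},$$ for all $j,\ell$; and there are $B_2>0$, independent of $\kappa$ and $\lambda$, and $A_2=A_2(\kappa)>0$, independent of $\lambda$, such that for every $j$ the set $\{J_j=0\}$ is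 nonempty and $$\mathcal N_{A_2/\lambda}(\{J_j=0\})\subseteq\{x:|J_j(x)|\le c_2/\lambda\}\subseteq\mathcal N_{B_2/\lambda}(\{J_j=0\}).$$ 2. For all $\kappa,\lambda>0$ and all $x\notin\mathcal B_{\rm in}\cup\mathcal B_{\rm out}$: $x\in\widehat C_{\kappa,\lambda}$ if and only if $x\in\bigcup_jP_j$. In particular, if moreover $x\in C$ or $\operatorname{dist}(x,C)>\varepsilon_{\rm cov}+\varepsilon_{\rm poly}$, then $\mathbf 1\{\Phi_{\kappa,\lambda}(x)\ge\frac12\}=1_C(x)$. 3. There are $\kappa,\lambda>0$ for which $\widehat C_{\kappa,\lambda}$ is nonempty and compact, $(*)$ holds, and $\mathbf 1\{\Phi_{\kappa,\lambda}(x)\ge\frac12\}=1_C(x)$ for every $x\in\mathbb{R}^d\setminus(\mathcal B_{\rm in}\cup\mathcal B_{\rm out})$. -/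

import Mathlib

noncomputable section

namespace BallCoverMLP

/-- The polytope (finite intersection of half-spaces) `{x : ⟪u_l, x⟫ ≤ h_l for all l}`. -/
def polytope {d m : ℕ} (u : Fin m → EuclideanSpace ℝ (Fin d)) (h : Fin m → ℝ) :
    Set (EuclideanSpace ℝ (Fin d)) :=
  {x | ∀ l, inner ℝ (u l) x ≤ h l}

/-- `polytope u h` is a polytope with exactly `m` facets circumscribed about the closed ball of
centre `c` and radius `r`: the outward unit normals are pairwise distinct, each of the `m`
hyperplanes is tangent to the ball, and the intersection of the half-spaces is bounded.
(A tangent hyperplane with a normal different from all the others carries a genuine facet,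
since its point of tangency satisfies all the other inequalities strictly.) -/
structure IsCircumscribed {d m : ℕ} (c : EuclideanSpace ℝ (Fin d)) (r : ℝ)
    (u : Fin m → EuclideanSpace ℝ (Fin d)) (h : Fin m → ℝ) : Prop where
  norm_eq_one : ∀ l, ‖u l‖ = 1
  injective : Function.Injective u
  support_eq : ∀ l, h l = inner ℝ (u l) c + r
  isCompact : IsCompact (polytope u h)

/-- First-layer half-space gate `σ(κ (h - ⟪u, x⟫))`, with `σ` the logistic function. -/
def gate {d : ℕ} (κ : ℝ) (u : EuclideanSpace ℝ (Fin d)) (h : ℝ)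
    (x : EuclideanSpace ℝ (Fin d)) : ℝ :=
  Real.sigmoid (κ * (h - inner ℝ u x))

/-- Centred score `J(x) = ∑_l s_l(x) - (m - 1/2)` of one polytope. -/
def score {d m : ℕ} (κ : ℝ) (u : Fin m → EuclideanSpace ℝ (Fin d)) (h : Fin m → ℝ)
    (x : EuclideanSpace ℝ (Fin d)) : ℝ :=
  ∑ l, gate κ (u l) (h l) x - ((m : ℝ) - 1 / 2)

/-- Output of the two-layer network, `Φ(x) = ∑_j σ(lam * J_j(x))`. -/
def aggregator {d R : ℕ} {m : Fin R → ℕ} (κ lam : ℝ)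
    (u : ∀ j, Fin (m j) → EuclideanSpace ℝ (Fin d)) (h : ∀ j, Fin (m j) → ℝ)
    (x : EuclideanSpace ℝ (Fin d)) : ℝ :=
  ∑ j, Real.sigmoid (lam * score κ (u j) (h j) x)

/-- The decision set `{x : Φ(x) ≥ 1/2}`, i.e. the set of points that the classifier labels `1`. -/
def decisionSet {d R : ℕ} {m : Fin R → ℕ} (κ lam : ℝ)
    (u : ∀ j, Fin (m j) → EuclideanSpace ℝ (Fin d)) (h : ∀ j, Fin (m j) → ℝ) :
    Set (EuclideanSpace ℝ (Fin d)) :=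
  {x | 1 / 2 ≤ aggregator κ lam u h x}

/-- The constant `log ((1 - η) / η)` (it is `c₁` for the inner tolerance `η`
and `c₂` for the outer tolerance `δ`). -/
def bandConst (η : ℝ) : ℝ := Real.log ((1 - η) / η)

/-- The uncertainty band of one gate: `{x : |h - ⟪u, x⟫| ≤ c₁ / κ}`. -/
def facetBand {d : ℕ} (η κ : ℝ) (u : EuclideanSpace ℝ (Fin d)) (h : ℝ) :
    Set (EuclideanSpace ℝ (Fin d)) :=
  {x | |h - inner ℝ u x| ≤ bandConst η / κ}

/-- The uncertainty band of one ball in the second layer: `{x : |J(x)| ≤ c₂ / lam}`. -/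
def ballBand {d m : ℕ} (δ κ lam : ℝ) (u : Fin m → EuclideanSpace ℝ (Fin d)) (h : Fin m → ℝ) :
    Set (EuclideanSpace ℝ (Fin d)) :=
  {x | |score κ u h x| ≤ bandConst δ / lam}

/-- The inner band `B_in`, the union of all facet bands. -/
def innerBand {d R : ℕ} {m : Fin R → ℕ} (η κ : ℝ)
    (u : ∀ j, Fin (m j) → EuclideanSpace ℝ (Fin d)) (h : ∀ j, Fin (m j) → ℝ) :
    Set (EuclideanSpace ℝ (Fin d)) :=
  ⋃ j, ⋃ l, facetBand η κ (u j l) (h j l)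

/-- The outer band `B_out`, the union of all ball bands. -/
def outerBand {d R : ℕ} {m : Fin R → ℕ} (δ κ lam : ℝ)
    (u : ∀ j, Fin (m j) → EuclideanSpace ℝ (Fin d)) (h : ∀ j, Fin (m j) → ℝ) :
    Set (EuclideanSpace ℝ (Fin d)) :=
  ⋃ j, ballBand δ κ lam (u j) (h j)

/-- The band `B` around the hypersurface `Z` has half-thickness between `s` and `t`: it contains
the closed tube of radius `s` around the (nonempty) set `Z`, and it is contained in the closed
tube of radius `t` around `Z`. -/
def HalfThicknessBetween {d : ℕ} (Z B : Set (EuclideanSpace ℝ (Fin d))) (s t : ℝ) : Prop :=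
  Z.Nonempty ∧ Metric.cthickening s Z ⊆ B ∧ B ⊆ Metric.cthickening t Z

end BallCoverMLP

end

/-!
Cover `C` by finitely many balls with centres in `C` and one common radius `r`, chosen so small that
`3 r` is below both `εcov` and `ε - εcov`. All balls get translates of the same polytope.

*The polytope.* Put `ρ = εpoly / r ≤ 1` and take a maximal `√ρ`-separated set of unit vectors as
outward normals. Each direction `v` then has a normal `u` with `(1 + ρ) ⟪u, v⟫ ≥ 1`, so the
polytope lies in the ball of radius `(1 + ρ) r = r + εpoly` (`IsDirectionNet`). The number of normals
is of order `ρ ^ (-(d - 1) / 2)`, by comparing volumes of small balls with the volume of a shell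
about the unit sphere (`card_mul_pow_le_of_separated`, `finrank_mul_le_card_mul_pow`).

*The network.* Off the bands each gate is within `η` of `0` or `1`, which separates the scores of
points inside and outside a polytope by sign and margin, and each second-layer unit is then within
`δ` of its ideal value (`mem_decisionSet_iff_of_notMem_bands`). A point of the decision set exceeds
the facets of some polytope by less than `c₁ / κ`; the direction net bounds its distance from the
centre by `(1 + ρ) (r + c₁ / κ)`. As soon as `c₁ / κ ≤ r` this is at most `εcov + εpoly`
(`IsDirectionNet.decisionSet_approx`).

*The bands.* A facet band is exactly a tube about its hyperplane. A ball band contains a tube because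
the score is Lipschitz. It is contained in a tube of radius independent of `κ` because the score
decreases along rays from the centre of the ball with slope bounded below wherever it is small: the
score is `1 / 2` minus the total defect of the gates, and where the defect is near `1 / 2` some gate
is not saturated, has a normal at an acute angle with the ray, and outweighs the exponentially small
contributions of the other side (`one_le_sum_mul_deriv_sigmoid`).

*Agreement with `C` off the bands.* Points of a polytope that are not in `C` must be covered by
the bands, so the slope is chosen with `c₁ / κ = r`. Since the normals do not lie in an open
half-space, each point of a polytope is at depth at most `r` below some facet, and the facet bands
contain the polytopes (`IsDirectionNet.iUnion_polytope_subset_innerBand`). The same `κ` still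
satisfies `c₁ / κ ≤ r`, so the Hausdorff bound holds as well.
-/

namespace BallCoverMLP

open Metric MeasureTheory Module

/-! ### Nets of directions -/

/-- A maximal `τ`-separated subset of a compact set is finite and is a `τ`-net. -/
theorem exists_separated_net {X : Type*} [PseudoMetricSpace X] {K : Set X} (hK : IsCompact K)
    {τ : ℝ} (hτ : 0 < τ) :
    ∃ S : Finset X, (∀ x ∈ S, x ∈ K) ∧ (∀ x ∈ S, ∀ y ∈ S, x ≠ y → τ < dist x y) ∧
      ∀ x ∈ K, ∃ y ∈ S, dist x y ≤ τ := by
  lift τ to NNReal using hτ.le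
  have hτ' : τ / 2 ≠ 0 := by
    have : τ ≠ 0 := by rintro rfl; simp at hτ
    simpa using this
  obtain ⟨N, -, hNfin, hN⟩ := exists_finite_isCover_of_isCompact hτ' hK
  have hpack : packingNumber τ K ≠ ⊤ := by
    have h := packingNumber_two_mul_le_externalCoveringNumber (τ / 2) K
    rw [mul_div_cancel₀ τ two_ne_zero] at h
    exact ((h.trans hN.externalCoveringNumber_le_encard).trans_lt hNfin.encard_lt_top).ne
  have hfin : (maximalSeparatedSet τ K).Finite := by
    rw [← Set.encard_ne_top_iff, encard_maximalSeparatedSet hpack]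
    exact hpack
  refine ⟨hfin.toFinset, fun x hx => maximalSeparatedSet_subset (hfin.mem_toFinset.1 hx),
    fun x hx y hy hxy => ?_, fun x hx => ?_⟩
  · have h := isSeparated_maximalSeparatedSet (hfin.mem_toFinset.1 hx) (hfin.mem_toFinset.1 hy) hxy
    have h : (τ : ENNReal) < edist x y := h
    rw [edist_nndist, ENNReal.coe_lt_coe] at h
    exact_mod_cast h
  · obtain ⟨y, hy, hxy⟩ := isCover_maximalSeparatedSet hpack hx
    refine ⟨y, hfin.mem_toFinset.2 hy, ?_⟩
    have hxy : edist x y ≤ τ := hxy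
    rw [edist_nndist, ENNReal.coe_le_coe] at hxy
    exact_mod_cast hxy

theorem one_add_pow_le_one_add_three_pow_mul {t : ℝ} (ht : 0 ≤ t) (ht1 : t ≤ 1) (n : ℕ) :
    (1 + t) ^ n ≤ 1 + 3 ^ n * t := by
  induction n with
  | zero => simpa using ht
  | succ n ih =>
    have h3 : (1 : ℝ) ≤ 3 ^ n := one_le_pow₀ (by norm_num)
    have h1 : (1 + t) ^ (n + 1) ≤ (1 + 3 ^ n * t) * (1 + t) := by
      rw [pow_succ]; gcongr
    have h2 : 3 ^ n * t * t ≤ 3 ^ n * t := mul_le_of_le_one_right (by positivity) ht1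
    have h4 : t ≤ 3 ^ n * t := le_mul_of_one_le_left ht h3
    rw [pow_succ (3 : ℝ)]
    linarith

section Volume

variable {E : Type*} [NormedAddCommGroup E] [NormedSpace ℝ E] [FiniteDimensional ℝ E]

/-- Packing bound: the balls of radius `τ / 2` about a `τ`-separated set of unit vectors are
pairwise disjoint and lie in a shell of thickness `τ` about the unit sphere. -/
theorem card_mul_pow_le_of_separated [Nontrivial E] {S : Finset E} {τ : ℝ} (hτ : 0 < τ) (hτ1 : τ ≤ 1)
    (hS : ∀ x ∈ S, ‖x‖ = 1) (hsep : ∀ x ∈ S, ∀ y ∈ S, x ≠ y → τ < dist x y) :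
    (S.card : ℝ) * (τ / 2) ^ finrank ℝ E ≤ (3 ^ finrank ℝ E + finrank ℝ E) * (τ / 2) := by
  let _ : MeasurableSpace E := borel E
  have _ : BorelSpace E := ⟨rfl⟩
  let μ : Measure E := Measure.addHaar
  set n := finrank ℝ E
  set t := τ / 2 with ht
  have ht0 : 0 < t := by positivity
  have hV : 0 < μ.real (ball (0 : E) 1) :=
    ENNReal.toReal_pos (measure_ball_pos μ _ one_pos).ne' measure_ball_lt_top.ne
  have hU : μ.real (⋃ x ∈ S, ball x t) = S.card * (t ^ n * μ.real (ball (0 : E) 1)) := by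
    rw [measureReal_biUnion_finset]
    · rw [Finset.sum_congr rfl fun x _ => ?_, Finset.sum_const, nsmul_eq_mul]
      rw [← Measure.addHaar_real_closedBall_eq_addHaar_real_ball,
        Measure.addHaar_real_closedBall μ x ht0.le]
    · intro x hx y hy hxy
      exact ball_disjoint_ball (by have := hsep x hx y hy hxy; linarith)
    · exact fun x _ => measurableSet_ball
  have hdisj : Disjoint (⋃ x ∈ S, ball x t) (ball (0 : E) (1 - t)) := by
    refine Set.disjoint_iUnion₂_left.2 fun x hx => ball_disjoint_ball ?_
    rw [dist_zero_right, hS x hx]; linarith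
  have hsub : (⋃ x ∈ S, ball x t) ∪ ball (0 : E) (1 - t) ⊆ closedBall 0 (1 + t) := by
    refine Set.union_subset (Set.iUnion₂_subset fun x hx => ?_)
      (ball_subset_closedBall.trans (closedBall_subset_closedBall (by linarith)))
    refine ball_subset_closedBall.trans (closedBall_subset_closedBall' ?_)
    rw [dist_zero_right, hS x hx]; linarith
  have hle := measureReal_mono hsub (μ := μ) measure_closedBall_lt_top.ne
  rw [measureReal_union hdisj measurableSet_ball
    ((measure_mono (Set.subset_union_left.trans hsub)).trans_lt measure_closedBall_lt_top).ne
    measure_ball_lt_top.ne, hU, Measure.addHaar_real_closedBall μ _ (by positivity)] at hle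
  have hB : μ.real (ball (0 : E) (1 - t)) = (1 - t) ^ n * μ.real (ball (0 : E) 1) := by
    rw [← Measure.addHaar_real_closedBall_eq_addHaar_real_ball,
      Measure.addHaar_real_closedBall μ _ (by linarith)]
  rw [hB] at hle
  have hle' : S.card * t ^ n + (1 - t) ^ n ≤ (1 + t) ^ n := by
    refine le_of_mul_le_mul_right ?_ hV
    linarith
  have h1 := one_add_pow_le_one_add_three_pow_mul ht0.le (by linarith) n
  have h2 := one_add_mul_le_pow (a := -t) (by linarith) n
  rw [← sub_eq_add_neg] at h2
  linarith

/-- Covering bound: if every unit vector is within `τ` of `S`, then the balls of radius `2 * τ`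
about the points of `S` cover the shell between the spheres of radii `1` and `1 + τ`. -/
theorem finrank_mul_le_card_mul_pow {S : Finset E} {τ : ℝ} (hτ : 0 < τ)
    (hcov : ∀ v : E, ‖v‖ = 1 → ∃ x ∈ S, dist v x ≤ τ) :
    (finrank ℝ E : ℝ) * τ ≤ S.card * (2 * τ) ^ finrank ℝ E := by
  let _ : MeasurableSpace E := borel E
  have _ : BorelSpace E := ⟨rfl⟩
  let μ : Measure E := Measure.addHaar
  set n := finrank ℝ E
  have hV : 0 < μ.real (ball (0 : E) 1) :=
    ENNReal.toReal_pos (measure_ball_pos μ _ one_pos).ne' measure_ball_lt_top.ne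
  have hsub : closedBall (0 : E) (1 + τ) ⊆ closedBall 0 1 ∪ ⋃ x ∈ S, closedBall x (2 * τ) := by
    intro y hy
    rw [mem_closedBall_zero_iff] at hy
    rcases le_or_gt ‖y‖ 1 with h | h
    · exact Or.inl (mem_closedBall_zero_iff.2 h)
    · right
      have hy0 : y ≠ 0 := by rintro rfl; simp at h; linarith
      obtain ⟨x, hx, hxy⟩ := hcov (‖y‖⁻¹ • y) (norm_smul_inv_norm (𝕜 := ℝ) hy0)
      refine Set.mem_iUnion₂.2 ⟨x, hx, mem_closedBall.2 ?_⟩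
      have hd : dist y (‖y‖⁻¹ • y) ≤ τ := by
        rw [dist_eq_norm, show y - ‖y‖⁻¹ • y = (1 - ‖y‖⁻¹) • y by rw [sub_smul, one_smul],
          norm_smul, Real.norm_of_nonneg (sub_nonneg.2 (inv_le_one_of_one_le₀ h.le)), sub_mul,
          inv_mul_cancel₀ (by positivity)]
        linarith
      linarith [dist_triangle y (‖y‖⁻¹ • y) x]
  have hfin : μ (closedBall (0 : E) 1 ∪ ⋃ x ∈ S, closedBall x (2 * τ)) ≠ ⊤ :=
    ((isCompact_closedBall _ _).union
      (S.isCompact_biUnion fun x _ => isCompact_closedBall _ _)).measure_lt_top.ne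
  have hle := (measureReal_mono hsub hfin).trans ((measureReal_union_le _ _).trans
    (add_le_add_right (measureReal_biUnion_finset_le S _) _))
  simp only [Measure.addHaar_real_closedBall μ _ (by positivity : (0 : ℝ) ≤ 2 * τ),
    Measure.addHaar_real_closedBall μ _ (by positivity : (0 : ℝ) ≤ 1 + τ),
    Measure.addHaar_real_closedBall μ _ zero_le_one, Finset.sum_const, nsmul_eq_mul] at hle
  have hle' : (1 + τ) ^ n ≤ 1 + S.card * (2 * τ) ^ n := by
    refine le_of_mul_le_mul_right ?_ hV
    rw [one_pow] at hle
    linarith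
  have h2 := one_add_mul_le_pow (a := τ) (by linarith) n
  linarith

end Volume

/-- Unit vectors within `√ρ` of each other, with `ρ ≤ 1`, make an angle of secant at most `1 + ρ`;
this is why a `√ρ`-net of normals gives a polytope within `ρ` of the unit ball. -/
theorem one_le_one_add_mul_inner {E : Type*} [NormedAddCommGroup E] [InnerProductSpace ℝ E]
    {u v : E} (hu : ‖u‖ = 1) (hv : ‖v‖ = 1) {ρ : ℝ} (hρ : 0 ≤ ρ) (hρ1 : ρ ≤ 1)
    (huv : dist v u ≤ √ρ) : 1 ≤ (1 + ρ) * inner ℝ u v := by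
  have h1 : ‖v - u‖ ^ 2 ≤ ρ := by
    rw [dist_eq_norm] at huv
    calc ‖v - u‖ ^ 2 ≤ √ρ ^ 2 := by gcongr
      _ = ρ := Real.sq_sqrt hρ
  rw [norm_sub_sq_real, hu, hv, real_inner_comm] at h1
  nlinarith

/-- The vectors `u l` are a net of directions: every `v` has length at most `1 + ρ` times its
component along some `u l`. For unit vectors `u l` this says that the polytope
`{x : ⟪u l, x⟫ ≤ 1}` lies in the ball of radius `1 + ρ`. The case `v = 0` forces the family to be
nonempty. -/
def IsDirectionNet {d m : ℕ} (ρ : ℝ) (u : Fin m → EuclideanSpace ℝ (Fin d)) : Prop :=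
  ∀ v, ∃ l, ‖v‖ ≤ (1 + ρ) * inner ℝ (u l) v

/-- The unit sphere of a Euclidean space has, for every `ρ ≤ 1`, a family of about
`ρ ^ (-(d - 1) / 2)` normals whose polytope is within `ρ` of the unit ball. -/
theorem exists_normals {d : ℕ} (hd : 2 ≤ d) {ρ : ℝ} (hρ : 0 < ρ) (hρ1 : ρ ≤ 1) :
    ∃ (m : ℕ) (u : Fin m → EuclideanSpace ℝ (Fin d)), (∀ l, ‖u l‖ = 1) ∧
      Function.Injective u ∧
      IsDirectionNet ρ u ∧
      (d / 2 ^ d : ℝ) * (1 / ρ) ^ (((d : ℝ) - 1) / 2) ≤ m ∧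
      (m : ℝ) ≤ ((3 ^ d + d) * 2 ^ d) * (1 / ρ) ^ (((d : ℝ) - 1) / 2) := by
  have : Nontrivial (EuclideanSpace ℝ (Fin d)) :=
    Module.nontrivial_of_finrank_pos (R := ℝ) (by rw [finrank_euclideanSpace_fin]; omega)
  set τ := √ρ with hτdef
  have hτ : 0 < τ := Real.sqrt_pos.2 hρ
  have hτ1 : τ ≤ 1 := Real.sqrt_le_one.2 hρ1
  obtain ⟨S, hS, hsep, hcov⟩ :=
    exists_separated_net (isCompact_sphere (0 : EuclideanSpace ℝ (Fin d)) 1) hτ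
  replace hS : ∀ x ∈ S, ‖x‖ = 1 := fun x hx => by simpa using hS x hx
  replace hcov : ∀ v : EuclideanSpace ℝ (Fin d), ‖v‖ = 1 → ∃ x ∈ S, dist v x ≤ τ :=
    fun v hv => hcov v (by simpa using hv)
  have hup := card_mul_pow_le_of_separated hτ hτ1 hS hsep
  have hlow := finrank_mul_le_card_mul_pow hτ hcov
  rw [finrank_euclideanSpace_fin] at hup hlow
  obtain ⟨n, rfl⟩ : ∃ n, d = n + 1 := ⟨d - 1, by omega⟩
  have hpow : (1 / ρ) ^ ((((n + 1 : ℕ) : ℝ) - 1) / 2) = (τ ^ n)⁻¹ := by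
    rw [one_div, Real.inv_rpow hρ.le, hτdef, Real.sqrt_eq_rpow, ← Real.rpow_natCast,
      ← Real.rpow_mul hρ.le]
    congr 2
    push_cast; ring
  have hτn : 0 < τ ^ n := by positivity
  refine ⟨S.card, fun l => (S.equivFin.symm l : EuclideanSpace ℝ (Fin (n + 1))),
    fun l => hS _ (S.equivFin.symm l).2,
    Subtype.val_injective.comp S.equivFin.symm.injective, fun v => ?_, ?_, ?_⟩
  · rcases eq_or_ne v 0 with rfl | hv
    · obtain ⟨w, hw⟩ := exists_norm_eq (EuclideanSpace ℝ (Fin (n + 1))) zero_le_one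
      obtain ⟨x, hx, -⟩ := hcov w hw
      exact ⟨S.equivFin ⟨x, hx⟩, by simp⟩
    · obtain ⟨x, hx, hxv⟩ := hcov (‖v‖⁻¹ • v) (norm_smul_inv_norm (𝕜 := ℝ) hv)
      have h := one_le_one_add_mul_inner (hS x hx) (norm_smul_inv_norm (𝕜 := ℝ) hv) hρ.le hρ1 hxv
      refine ⟨S.equivFin ⟨x, hx⟩, ?_⟩
      rw [real_inner_smul_right, mul_left_comm, inv_mul_eq_div, one_le_div₀ (by positivity)] at h
      simpa using h
  · rw [hpow, ← div_eq_mul_inv, div_le_iff₀ hτn, div_le_iff₀ (by positivity)]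
    refine le_of_mul_le_mul_right ?_ hτ
    rw [mul_pow, pow_succ τ] at hlow
    linarith
  · rw [hpow, ← div_eq_mul_inv, le_div_iff₀ hτn]
    have h : (S.card : ℝ) * (τ / 2) ^ n ≤ 3 ^ (n + 1) + (n + 1 : ℕ) := by
      refine le_of_mul_le_mul_right ?_ (half_pos hτ)
      rw [pow_succ (τ / 2), ← mul_assoc] at hup
      exact hup
    rw [div_pow, ← mul_div_assoc, div_le_iff₀ (by positivity)] at h
    refine h.trans (mul_le_mul_of_nonneg_left ?_ (by positivity))
    exact pow_le_pow_right₀ one_le_two n.le_succ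

/-! ### Circumscribed polytopes -/

section Circumscribed

variable {d m : ℕ} {u : Fin m → EuclideanSpace ℝ (Fin d)} {ρ r s : ℝ}
  {c x : EuclideanSpace ℝ (Fin d)}

/-- The case `s = r` bounds the circumscribed polytope; larger `s` bounds the set of points that
violate the facet inequalities by at most `s - r`. -/
theorem IsDirectionNet.norm_sub_le (hu : IsDirectionNet ρ u) (hρ : 0 ≤ ρ)
    (hx : ∀ l, inner ℝ (u l) x ≤ inner ℝ (u l) c + s) : ‖x - c‖ ≤ (1 + ρ) * s := by
  obtain ⟨l, hl⟩ := hu (x - c)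
  refine hl.trans (mul_le_mul_of_nonneg_left ?_ (by positivity))
  rw [inner_sub_right]
  linarith [hx l]

theorem closedBall_subset_polytope (hu : ∀ l, ‖u l‖ = 1) :
    closedBall c r ⊆ polytope u fun l => inner ℝ (u l) c + r := by
  intro x hx l
  rw [mem_closedBall, dist_eq_norm] at hx
  have h := real_inner_le_norm (u l) (x - c)
  rw [hu l, one_mul, inner_sub_right] at h
  linarith

theorem IsDirectionNet.polytope_subset (hu : IsDirectionNet ρ u) (hρ : 0 ≤ ρ) :
    (polytope u fun l => inner ℝ (u l) c + r) ⊆ closedBall c ((1 + ρ) * r) := by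
  intro x hx
  rw [mem_closedBall, dist_eq_norm]
  exact hu.norm_sub_le hρ hx

theorem isClosed_polytope (u : Fin m → EuclideanSpace ℝ (Fin d)) (h : Fin m → ℝ) :
    IsClosed (polytope u h) := by
  simp only [polytope, Set.ofPred_forall]
  exact isClosed_iInter fun l => isClosed_le (by fun_prop) continuous_const

theorem IsDirectionNet.isCircumscribed (hu : IsDirectionNet ρ u) (hρ : 0 ≤ ρ)
    (hu1 : ∀ l, ‖u l‖ = 1) (hinj : Function.Injective u) :
    IsCircumscribed c r u fun l => inner ℝ (u l) c + r where
  norm_eq_one := hu1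
  injective := hinj
  support_eq _ := rfl
  isCompact := isCompact_of_isClosed_isBounded (isClosed_polytope _ _)
    (isBounded_closedBall.subset (hu.polytope_subset hρ))

theorem exists_mem_closedBall_dist_le {E : Type*} [NormedAddCommGroup E] [NormedSpace ℝ E]
    {c x : E} {r t : ℝ} (hr : 0 < r) (ht : 0 ≤ t) (hx : x ∈ closedBall c (r + t)) :
    ∃ y ∈ closedBall c r, dist x y ≤ t := by
  rw [mem_closedBall] at hx
  by_cases hxr : dist x c ≤ r
  · exact ⟨x, hxr, by simpa using ht⟩
  · push Not at hxr
    have hd : 0 < ‖x - c‖ := by rw [← dist_eq_norm]; linarith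
    rw [dist_eq_norm] at hx hxr
    refine ⟨c + (r / ‖x - c‖) • (x - c), ?_, ?_⟩
    · rw [mem_closedBall, dist_self_add_left, norm_smul, Real.norm_of_nonneg (by positivity),
        div_mul_cancel₀ _ hd.ne']
    · rw [dist_eq_norm, show x - (c + (r / ‖x - c‖) • (x - c)) = (1 - r / ‖x - c‖) • (x - c) by
        rw [sub_smul, one_smul]; abel, norm_smul,
        Real.norm_of_nonneg (sub_nonneg.2 ((div_le_one hd).2 hxr.le)), sub_mul,
        div_mul_cancel₀ _ hd.ne']
      linarith

theorem IsDirectionNet.hausdorffDist_polytope_le (hu : IsDirectionNet ρ u) (hρ : 0 ≤ ρ)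
    (hu1 : ∀ l, ‖u l‖ = 1) (hr : 0 < r) :
    hausdorffDist (polytope u fun l => inner ℝ (u l) c + r) (closedBall c r) ≤ ρ * r := by
  refine hausdorffDist_le_of_mem_dist (by positivity) (fun x hx => ?_)
    fun x hx => ⟨x, closedBall_subset_polytope hu1 hx, by simp; positivity⟩
  refine exists_mem_closedBall_dist_le hr (by positivity) ?_
  have := hu.polytope_subset hρ hx
  rwa [one_add_mul] at this

/-- The outward normals of a bounded polytope do not lie in an open half-space, so every point of
the polytope is at most `r` below one of its facets. -/
theorem IsDirectionNet.exists_le_inner (hu : IsDirectionNet ρ u) (hρ : 0 ≤ ρ)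
    (c x : EuclideanSpace ℝ (Fin d)) : ∃ l, inner ℝ (u l) c ≤ inner ℝ (u l) x := by
  obtain ⟨l, hl⟩ := hu (x - c)
  refine ⟨l, ?_⟩
  have h : 0 ≤ inner ℝ (u l) (x - c) :=
    nonneg_of_mul_nonneg_right ((norm_nonneg _).trans hl) (by positivity)
  rw [inner_sub_right] at h
  linarith

end Circumscribed

/-! ### The logistic function and the band constants -/

section Sigmoid

theorem bandConst_pos {η : ℝ} (h0 : 0 < η) (h : η < 1 / 2) : 0 < bandConst η :=
  Real.log_pos ((one_lt_div h0).2 (by linarith))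

theorem sigmoid_bandConst {η : ℝ} (h0 : 0 < η) (h1 : η < 1) :
    Real.sigmoid (bandConst η) = 1 - η := by
  rw [Real.sigmoid_def, bandConst, Real.exp_neg, Real.exp_log (div_pos (by linarith) h0), inv_div]
  have : 1 - η ≠ 0 := by linarith
  field_simp
  ring

theorem sigmoid_neg_bandConst {η : ℝ} (h0 : 0 < η) (h1 : η < 1) :
    Real.sigmoid (-bandConst η) = η := by
  rw [Real.sigmoid_neg, sigmoid_bandConst h0 h1, sub_sub_cancel]

theorem sigmoid_le_exp (z : ℝ) : Real.sigmoid z ≤ Real.exp z := by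
  have h := Real.sigmoid_mul_rexp_neg (-z)
  rw [neg_neg] at h
  rw [← h]
  exact mul_le_of_le_one_left (Real.exp_pos z).le (Real.sigmoid_le_one _)

theorem lipschitzWith_sigmoid : LipschitzWith 1 Real.sigmoid := by
  refine lipschitzWith_of_nnnorm_deriv_le differentiable_sigmoid fun x => ?_
  rw [← NNReal.coe_le_coe, coe_nnnorm, Real.deriv_sigmoid, Real.norm_of_nonneg]
  · exact mul_le_one₀ (Real.sigmoid_le_one x) (sub_nonneg.2 (Real.sigmoid_le_one x))
      (sub_le_self _ (Real.sigmoid_nonneg x))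
  · exact mul_nonneg (Real.sigmoid_nonneg x) (sub_nonneg.2 (Real.sigmoid_le_one x))

end Sigmoid

/-! ### The score of one polytope -/

section Score

variable {d m : ℕ} {u : Fin m → EuclideanSpace ℝ (Fin d)} {h : Fin m → ℝ} {κ η : ℝ}
  {x : EuclideanSpace ℝ (Fin d)}

/-- The score is `1 / 2` minus the total defect of the gates, because `1 - σ(z) = σ(-z)`. -/
theorem score_eq (κ : ℝ) (u : Fin m → EuclideanSpace ℝ (Fin d)) (h : Fin m → ℝ)
    (x : EuclideanSpace ℝ (Fin d)) :
    score κ u h x = 1 / 2 - ∑ l, Real.sigmoid (κ * (inner ℝ (u l) x - h l)) := by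
  have hl : ∀ l, Real.sigmoid (κ * (inner ℝ (u l) x - h l)) = 1 - gate κ (u l) (h l) x := by
    intro l
    rw [gate, ← Real.sigmoid_neg]
    congr 1; ring
  rw [Finset.sum_congr rfl fun l _ => hl l, Finset.sum_sub_distrib, score]
  simp
  ring

theorem continuous_score (κ : ℝ) (u : Fin m → EuclideanSpace ℝ (Fin d)) (h : Fin m → ℝ) :
    Continuous (score κ u h) := by
  have := continuous_sigmoid
  unfold score gate
  fun_prop

/-- If all gates are within `η` of `1`, the score is positive with a margin. -/
theorem quarter_le_score (hκ : 0 < κ) (hη : 0 < η) (hη1 : η < 1) (hm : m * η ≤ 1 / 4)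
    (hx : ∀ l, bandConst η / κ ≤ h l - inner ℝ (u l) x) : 1 / 4 ≤ score κ u h x := by
  rw [score_eq]
  have hle : ∑ l, Real.sigmoid (κ * (inner ℝ (u l) x - h l)) ≤ ∑ _l : Fin m, η := by
    refine Finset.sum_le_sum fun l _ => ?_
    conv_rhs => rw [← sigmoid_neg_bandConst hη hη1]
    refine Real.sigmoid_le ?_
    have := (div_le_iff₀' hκ).1 (hx l)
    linarith
  rw [Finset.sum_const, Finset.card_univ, Fintype.card_fin, nsmul_eq_mul] at hle
  linarith

/-- A single gate within `η` of `0` makes the score negative with a margin. -/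
theorem score_le_of_exists (hκ : 0 < κ) (hη : 0 < η) (hη1 : η < 1)
    (hx : ∃ l, bandConst η / κ ≤ inner ℝ (u l) x - h l) : score κ u h x ≤ η - 1 / 2 := by
  obtain ⟨l, hl⟩ := hx
  have h1 : Real.sigmoid (κ * (inner ℝ (u l) x - h l)) ≤
      ∑ l, Real.sigmoid (κ * (inner ℝ (u l) x - h l)) :=
    Finset.single_le_sum (f := fun l => Real.sigmoid (κ * (inner ℝ (u l) x - h l)))
      (fun _ _ => Real.sigmoid_nonneg _) (Finset.mem_univ l)
  have h2 : 1 - η ≤ Real.sigmoid (κ * (inner ℝ (u l) x - h l)) := by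
    rw [← sigmoid_bandConst hη hη1]
    exact Real.sigmoid_le ((div_le_iff₀' hκ).1 hl)
  rw [score_eq]
  linarith

theorem abs_score_sub_score_le (hu : ∀ l, ‖u l‖ = 1) (hκ : 0 ≤ κ)
    (x y : EuclideanSpace ℝ (Fin d)) :
    |score κ u h x - score κ u h y| ≤ m * κ * dist x y := by
  have hl : ∀ l, |gate κ (u l) (h l) x - gate κ (u l) (h l) y| ≤ κ * dist x y := by
    intro l
    have h1 := lipschitzWith_sigmoid.dist_le_mul (κ * (h l - inner ℝ (u l) x))
      (κ * (h l - inner ℝ (u l) y))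
    rw [NNReal.coe_one, one_mul, Real.dist_eq, Real.dist_eq, ← mul_sub, sub_sub_sub_cancel_left,
      ← inner_sub_right, abs_mul, abs_of_nonneg hκ] at h1
    refine h1.trans (mul_le_mul_of_nonneg_left ?_ hκ)
    have h2 := abs_real_inner_le_norm (u l) (y - x)
    rwa [hu l, one_mul, ← dist_eq_norm, dist_comm] at h2
  rw [score, score, sub_sub_sub_cancel_right, ← Finset.sum_sub_distrib]
  refine (Finset.abs_sum_le_sum_abs _ _).trans ((Finset.sum_le_sum fun l _ => hl l).trans_eq ?_)
  simp [mul_assoc]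

end Score

/-! ### The decision set -/

section Aggregator

variable {d R : ℕ} {m : Fin R → ℕ} {κ lam η δ : ℝ}
  {u : ∀ j, Fin (m j) → EuclideanSpace ℝ (Fin d)} {h : ∀ j, Fin (m j) → ℝ}
  {x : EuclideanSpace ℝ (Fin d)}

theorem isClosed_decisionSet (κ lam : ℝ) (u : ∀ j, Fin (m j) → EuclideanSpace ℝ (Fin d))
    (h : ∀ j, Fin (m j) → ℝ) : IsClosed (decisionSet κ lam u h) := by
  have := continuous_sigmoid
  have := fun j => continuous_score κ (u j) (h j)
  refine isClosed_le continuous_const ?_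
  unfold aggregator
  fun_prop

theorem mem_decisionSet_of_score_nonneg (hlam : 0 ≤ lam) {j : Fin R}
    (hj : 0 ≤ score κ (u j) (h j) x) : x ∈ decisionSet κ lam u h := by
  have h1 : Real.sigmoid (lam * score κ (u j) (h j) x) ≤ aggregator κ lam u h x :=
    Finset.single_le_sum (f := fun j => Real.sigmoid (lam * score κ (u j) (h j) x))
      (fun _ _ => Real.sigmoid_nonneg _) (Finset.mem_univ j)
  have h2 := Real.sigmoid_le (mul_nonneg hlam hj)
  rw [Real.sigmoid_zero] at h2
  change 1 / 2 ≤ aggregator κ lam u h x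
  linarith

theorem notMem_decisionSet (hδ : 0 < δ) (hδ1 : δ < 1) (hR : R * δ ≤ 1 / 4) (hlam : 0 < lam)
    (hx : ∀ j, score κ (u j) (h j) x ≤ -(bandConst δ / lam)) : x ∉ decisionSet κ lam u h := by
  have hle : aggregator κ lam u h x ≤ ∑ _j : Fin R, δ := by
    refine Finset.sum_le_sum fun j _ => ?_
    conv_rhs => rw [← sigmoid_neg_bandConst hδ hδ1]
    refine Real.sigmoid_le ?_
    have := hx j
    rw [← neg_div, le_div_iff₀' hlam] at this
    exact this
  rw [Finset.sum_const, Finset.card_univ, Fintype.card_fin, nsmul_eq_mul] at hle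
  intro hmem
  have hmem : 1 / 2 ≤ aggregator κ lam u h x := hmem
  linarith

/-- Off the two bands every gate and every ball score is within tolerance of its ideal value, so
the network computes membership in the union of the polytopes. -/
theorem mem_decisionSet_iff_of_notMem_bands (hη : 0 < η) (hη1 : η < 1 / 2)
    (hm : ∀ j, m j * η ≤ 1 / 4) (hδ : 0 < δ) (hδ1 : δ < 1) (hR : R * δ ≤ 1 / 4)
    (hκ : 0 < κ) (hlam : 0 < lam) (hin : x ∉ innerBand η κ u h)
    (hout : x ∉ outerBand δ κ lam u h) :
    x ∈ decisionSet κ lam u h ↔ x ∈ ⋃ j, polytope (u j) (h j) := by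
  simp only [innerBand, facetBand, Set.mem_iUnion, Set.mem_ofPred_eq, not_exists, not_le] at hin
  simp only [outerBand, ballBand, Set.mem_iUnion, Set.mem_ofPred_eq, not_exists, not_le] at hout
  have hc : 0 < bandConst η / κ := div_pos (bandConst_pos hη hη1) hκ
  constructor
  · contrapose
    intro hx
    refine notMem_decisionSet hδ hδ1 hR hlam fun j => ?_
    have hxj : ∃ l, h j l < inner ℝ (u j l) x := by
      by_contra! hcon
      exact hx (Set.mem_iUnion.2 ⟨j, hcon⟩)
    obtain ⟨l, hl⟩ := hxj
    have h1 := hin j l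
    rw [abs_of_neg (by linarith)] at h1
    have h2 : score κ (u j) (h j) x ≤ η - 1 / 2 :=
      score_le_of_exists hκ hη (by linarith) ⟨l, by linarith⟩
    have h3 := hout j
    rw [abs_of_neg (by linarith)] at h3
    linarith
  · intro hx
    obtain ⟨j, hj⟩ := Set.mem_iUnion.1 hx
    refine mem_decisionSet_of_score_nonneg hlam.le (j := j) ?_
    refine le_trans (by norm_num) (quarter_le_score hκ hη (by linarith) (hm j) fun l => ?_)
    have h1 := hin j l
    rw [abs_of_nonneg (sub_nonneg.2 (hj l))] at h1
    exact h1.le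

/-- If the second layer is steep enough, then each point of the decision set violates the
inequalities of one of the polytopes by less than the half-width of the inner band. -/
theorem exists_forall_lt_of_mem_decisionSet (hη : 0 < η) (hη1 : η ≤ 1 / 4)
    (hδ : 0 < δ) (hδ1 : δ < 1) (hR : R * δ ≤ 1 / 4) (hκ : 0 < κ) (hlam : 0 < lam)
    (hδlam : bandConst δ / lam ≤ 1 / 4) (hx : x ∈ decisionSet κ lam u h) :
    ∃ j, ∀ l, inner ℝ (u j l) x < h j l + bandConst η / κ := by
  by_contra! hcon
  refine notMem_decisionSet hδ hδ1 hR hlam (fun j => ?_) hx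
  obtain ⟨l, hl⟩ := hcon j
  have := score_le_of_exists hκ hη (by linarith) ⟨l, le_sub_iff_add_le'.2 hl⟩
  linarith

end Aggregator

/-! ### Thickness of the facet bands -/

section FacetBand

variable {d : ℕ} {u : EuclideanSpace ℝ (Fin d)} {h η κ : ℝ}

/-- The band of one gate is exactly the closed tube of radius `c₁ / κ` about its hyperplane. -/
theorem halfThicknessBetween_facetBand (hu : ‖u‖ = 1) (hη : 0 ≤ bandConst η / κ) :
    HalfThicknessBetween {x | inner ℝ u x = h} (facetBand η κ u h)
      (bandConst η / κ) (bandConst η / κ) := by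
  have huu : inner ℝ u u = (1 : ℝ) := by rw [real_inner_self_eq_norm_sq, hu, one_pow]
  have hne : {x : EuclideanSpace ℝ (Fin d) | inner ℝ u x = h}.Nonempty :=
    ⟨h • u, show inner ℝ u (h • u) = h by rw [real_inner_smul_right, huu, mul_one]⟩
  refine ⟨hne, fun x hx => ?_, fun x hx => ?_⟩
  · have hcl : IsClosed {x : EuclideanSpace ℝ (Fin d) | inner ℝ u x = h} :=
      isClosed_eq (by fun_prop) continuous_const
    rw [hcl.cthickening_eq_biUnion_closedBall hη] at hx
    obtain ⟨y, hy, hxy⟩ := Set.mem_iUnion₂.1 hx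
    have hy : inner ℝ u y = h := hy
    have h2 := abs_real_inner_le_norm u (y - x)
    rw [hu, one_mul, inner_sub_right, hy, ← dist_eq_norm, dist_comm] at h2
    exact h2.trans hxy
  · have hx : |h - inner ℝ u x| ≤ bandConst η / κ := hx
    refine mem_cthickening_of_dist_le x (x + (h - inner ℝ u x) • u) _ _ ?_ ?_
    · change inner ℝ u (x + (h - inner ℝ u x) • u) = h
      rw [inner_add_right, real_inner_smul_right, huu]
      ring
    · rwa [dist_self_add_right, norm_smul, hu, mul_one, Real.norm_eq_abs]

end FacetBand

/-! ### Growth of the total defect along rays -/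

section Radial

/-- A function whose slope exceeds `q` as long as its values are in `[-τ, 0]` climbs from `-τ`
to `0` within a distance `τ / q`. -/
theorem exists_zero_of_lt_deriv {g g' : ℝ → ℝ} {τ q : ℝ} (hτ : 0 ≤ τ) (hq : 0 < q)
    (hg : ∀ s, HasDerivAt g (g' s) s)
    (hg' : ∀ s ∈ Set.Icc 0 (τ / q), g s ∈ Set.Icc (-τ) 0 → q < g' s) (h0 : g 0 = -τ) :
    ∃ s ∈ Set.Icc 0 (τ / q), g s = 0 := by
  have hτq : 0 ≤ τ / q := by positivity
  have hcont : Continuous g := continuous_iff_continuousAt.2 fun s => (hg s).continuousAt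
  have hend : -g (τ / q) ≤ τ - q * (τ / q) := by
    refine image_le_of_deriv_right_lt_deriv_boundary (f := fun s => -g s) (f' := fun s => -g' s)
      (a := 0) (b := τ / q) (B := fun s => τ - q * s) (B' := fun _ => -q)
      hcont.neg.continuousOn (fun s _ => (hg s).neg.hasDerivWithinAt) (by simp [h0])
      (fun s => ?_) (fun s hs hgs => ?_) (Set.right_mem_Icc.2 hτq)
    · simpa using ((hasDerivAt_id s).const_mul q).const_sub τ
    · have h1 : q * s ≤ τ := by
        have := (le_div_iff₀' hq).1 hs.2.le
        exact this
      have h2 : 0 ≤ q * s := mul_nonneg hq.le hs.1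
      exact neg_lt_neg (hg' s ⟨hs.1, hs.2.le⟩ ⟨by linarith, by linarith⟩)
  rw [mul_div_cancel₀ _ hq.ne', sub_self] at hend
  have := intermediate_value_Icc hτq hcont.continuousOn
    (show (0 : ℝ) ∈ Set.Icc (g 0) (g (τ / q)) from ⟨by linarith, by linarith⟩)
  exact this

/-- With `z = κ (⟪u, w⟫ - r)` and `K = κ r`, the factor `z + K = κ ⟪u, w⟫` is negative only
for normals at an obtuse angle with `w`, and there the derivative of `σ` is exponentially small. -/
theorem neg_exp_neg_le_mul_sigmoid (K z : ℝ) :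
    -Real.exp (-K) ≤ (z + K) * (Real.sigmoid z * (1 - Real.sigmoid z)) := by
  have hs := Real.sigmoid_nonneg z
  have hs1 := sub_nonneg.2 (Real.sigmoid_le_one z)
  rcases le_or_gt 0 (z + K) with h | h
  · exact (neg_nonpos.2 (Real.exp_pos _).le).trans (by positivity)
  · have h1 : Real.sigmoid z * (1 - Real.sigmoid z) ≤ Real.exp z :=
      (mul_le_of_le_one_right hs (sub_le_self _ hs)).trans (sigmoid_le_exp z)
    have h2 : -(z + K) * (Real.sigmoid z * (1 - Real.sigmoid z)) ≤ -(z + K) * Real.exp z :=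
      mul_le_mul_of_nonneg_left h1 (by linarith)
    have h3 : -(z + K) * Real.exp z ≤ Real.exp (-K) := by
      have h4 : -(z + K) ≤ Real.exp (-(z + K)) := by
        linarith [Real.add_one_le_exp (-(z + K))]
      calc -(z + K) * Real.exp z ≤ Real.exp (-(z + K)) * Real.exp z :=
            mul_le_mul_of_nonneg_right h4 (Real.exp_pos z).le
        _ = Real.exp (-K) := by rw [← Real.exp_add]; congr 1; ring
    linarith

/-- The radial derivative of the total defect `∑ σ(z l)` is bounded below where the defect is near
`1 / 2`. Some gate then contributes at least `3 / (8 m)` and is not saturated, and its normal makes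
an acute angle with the radius. The normals at obtuse angles have saturated gates and contribute
only `O(exp (-K))`. -/
theorem one_le_sum_mul_deriv_sigmoid {m : ℕ} {z : Fin m → ℝ} {K : ℝ} (hK : 20 * m ≤ K)
    (hlow : 3 / 8 ≤ ∑ l, Real.sigmoid (z l)) (hup : ∑ l, Real.sigmoid (z l) ≤ 5 / 8) :
    1 ≤ ∑ l, (z l + K) * (Real.sigmoid (z l) * (1 - Real.sigmoid (z l))) := by
  have hm : 0 < m := by
    rcases Nat.eq_zero_or_pos m with rfl | hm
    · norm_num at hlow
    · exact hm
  have hm1 : (1 : ℝ) ≤ m := by exact_mod_cast hm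
  have hm0 : (0 : ℝ) < m := by linarith
  have : Nonempty (Fin m) := ⟨⟨0, hm⟩⟩
  obtain ⟨l, hl⟩ : ∃ l, 3 / (8 * m) ≤ Real.sigmoid (z l) := by
    by_contra! hcon
    have h := Finset.sum_lt_sum_of_nonempty (Finset.univ_nonempty (α := Fin m))
      fun l _ => hcon l
    rw [Finset.sum_const, Finset.card_univ, Fintype.card_fin, nsmul_eq_mul] at h
    have : (m : ℝ) * (3 / (8 * m)) = 3 / 8 := by field_simp
    linarith
  have hl1 : Real.sigmoid (z l) ≤ 5 / 8 :=
    (Finset.single_le_sum (f := fun l => Real.sigmoid (z l))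
      (fun _ _ => Real.sigmoid_nonneg _) (Finset.mem_univ l)).trans hup
  have hz : -(3 * m) ≤ z l := by
    have h1 := hl.trans (sigmoid_le_exp (z l))
    have h2 : Real.exp (-z l) ≤ 3 * m := by
      rw [Real.exp_neg]
      refine (inv_anti₀ (by positivity) h1).trans ?_
      rw [inv_div]
      linarith
    linarith [Real.add_one_le_exp (-z l)]
  have hmain : 2 ≤ (z l + K) * (Real.sigmoid (z l) * (1 - Real.sigmoid (z l))) := by
    have h1 : 3 / (8 * m) * (3 / 8) ≤ Real.sigmoid (z l) * (1 - Real.sigmoid (z l)) :=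
      mul_le_mul hl (by linarith) (by norm_num) (Real.sigmoid_nonneg _)
    have h2 : 17 * (m : ℝ) ≤ z l + K := by linarith
    calc (2 : ℝ) ≤ 17 * m * (3 / (8 * m) * (3 / 8)) := by field_simp; norm_num
      _ ≤ _ := mul_le_mul h2 h1 (by positivity) (by linarith)
  have hrest : -1 ≤ ∑ k ∈ Finset.univ.erase l,
      (z k + K) * (Real.sigmoid (z k) * (1 - Real.sigmoid (z k))) := by
    have h1 := Finset.card_nsmul_le_sum (Finset.univ.erase l)
      (fun k => (z k + K) * (Real.sigmoid (z k) * (1 - Real.sigmoid (z k)))) (-Real.exp (-K))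
      fun k _ => neg_exp_neg_le_mul_sigmoid K (z k)
    refine le_trans ?_ h1
    rw [nsmul_eq_mul]
    have h2 : ((Finset.univ.erase l).card : ℝ) ≤ m := by
      exact_mod_cast (Finset.card_le_univ _).trans_eq (Fintype.card_fin m)
    have h3 : (m : ℝ) * Real.exp (-K) ≤ 1 := by
      rw [Real.exp_neg, ← div_eq_mul_inv, div_le_one (Real.exp_pos _)]
      linarith [Real.add_one_le_exp K]
    have h4 := mul_le_mul_of_nonneg_right h2 (Real.exp_pos (-K)).le
    linarith
  rw [← Finset.add_sum_erase _ _ (Finset.mem_univ l)]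
  linarith

end Radial

/-! ### Thickness of the ball bands -/

section BallBand

variable {d m : ℕ} {u : Fin m → EuclideanSpace ℝ (Fin d)} {ρ r κ η : ℝ}
  {c x : EuclideanSpace ℝ (Fin d)}

theorem score_add_smul (κ : ℝ) (u : Fin m → EuclideanSpace ℝ (Fin d)) (r : ℝ)
    (c w : EuclideanSpace ℝ (Fin d)) (s : ℝ) :
    score κ u (fun l => inner ℝ (u l) c + r) (c + s • w) =
      1 / 2 - ∑ l, Real.sigmoid (κ * (s * inner ℝ (u l) w - r)) := by
  rw [score_eq]
  congr 1
  refine Finset.sum_congr rfl fun l _ => ?_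
  rw [inner_add_right, real_inner_smul_right, add_sub_add_left_eq_sub]

theorem hasDerivAt_score_add_smul (κ : ℝ) (u : Fin m → EuclideanSpace ℝ (Fin d)) (r : ℝ)
    (c w : EuclideanSpace ℝ (Fin d)) (s : ℝ) :
    HasDerivAt (fun s : ℝ => score κ u (fun l => inner ℝ (u l) c + r) (c + s • w))
      (-∑ l, κ * inner ℝ (u l) w * (Real.sigmoid (κ * (s * inner ℝ (u l) w - r)) *
        (1 - Real.sigmoid (κ * (s * inner ℝ (u l) w - r))))) s := by
  simp only [score_add_smul]
  refine HasDerivAt.const_sub _ (HasDerivAt.fun_sum fun l _ => ?_)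
  have h1 : HasDerivAt (fun s : ℝ => κ * (s * inner ℝ (u l) w - r)) (κ * inner ℝ (u l) w) s := by
    simpa using (((hasDerivAt_id s).mul_const (inner ℝ (u l) w)).sub_const r).const_mul κ
  have h2 := (Real.hasDerivAt_sigmoid (κ * (s * inner ℝ (u l) w - r))).comp s h1
  rw [mul_comm] at h2
  exact h2

/-- Where the score is small, it decreases along every ray from the centre, at a rate that does
not depend on the slope `κ`. -/
theorem half_le_sum_of_abs_score_le (hK : 20 * m ≤ κ * r) {w : EuclideanSpace ℝ (Fin d)} {s : ℝ}
    (hs : 0 < s) (hs2 : s ≤ 2)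
    (hsc : |score κ u (fun l => inner ℝ (u l) c + r) (c + s • w)| ≤ 1 / 8) :
    1 / 2 ≤ ∑ l, κ * inner ℝ (u l) w * (Real.sigmoid (κ * (s * inner ℝ (u l) w - r)) *
        (1 - Real.sigmoid (κ * (s * inner ℝ (u l) w - r)))) := by
  rw [score_add_smul, abs_le] at hsc
  have h := one_le_sum_mul_deriv_sigmoid (z := fun l => κ * (s * inner ℝ (u l) w - r)) hK
    (by linarith) (by linarith)
  have heq : ∑ l, (κ * (s * inner ℝ (u l) w - r) + κ * r) *
      (Real.sigmoid (κ * (s * inner ℝ (u l) w - r)) *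
        (1 - Real.sigmoid (κ * (s * inner ℝ (u l) w - r)))) =
      s * ∑ l, κ * inner ℝ (u l) w * (Real.sigmoid (κ * (s * inner ℝ (u l) w - r)) *
        (1 - Real.sigmoid (κ * (s * inner ℝ (u l) w - r)))) := by
    rw [Finset.mul_sum]
    exact Finset.sum_congr rfl fun l _ => by ring
  rw [heq] at h
  nlinarith

/-- From a point with a small score the zero set is reached along the ray from the centre, at a
distance that does not involve `κ`. -/
theorem exists_score_eq_zero_of_abs_score_le (hK : 20 * m ≤ κ * r) {τ : ℝ}
    (hτ : τ ≤ 1 / 8) (hx : |score κ u (fun l => inner ℝ (u l) c + r) x| ≤ τ) :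
    ∃ y, score κ u (fun l => inner ℝ (u l) c + r) y = 0 ∧ dist x y ≤ 4 * τ * ‖x - c‖ := by
  set w := x - c with hw
  have hxw : x = c + (1 : ℝ) • w := by rw [one_smul, hw, add_sub_cancel]
  set F : ℝ → ℝ := fun s => score κ u (fun l => inner ℝ (u l) c + r) (c + s • w) with hF
  set G : ℝ → ℝ := fun s => ∑ l, κ * inner ℝ (u l) w *
    (Real.sigmoid (κ * (s * inner ℝ (u l) w - r)) *
        (1 - Real.sigmoid (κ * (s * inner ℝ (u l) w - r)))) with hG
  have hFG : ∀ s, HasDerivAt F (-G s) s := hasDerivAt_score_add_smul κ u r c w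
  have hlow : ∀ s, 0 < s → s ≤ 2 → |F s| ≤ 1 / 8 → 1 / 4 < G s := fun s h0 h2 h =>
    lt_of_lt_of_le (by norm_num) (half_le_sum_of_abs_score_le hK h0 h2 h)
  have hF1 : |F 1| ≤ τ := by rw [hF]; dsimp only; rwa [← hxw]
  -- The zero is found on the ray through `x`, outwards or inwards according to the sign of the
  -- score.
  obtain ⟨s, hs, hs0⟩ : ∃ s : ℝ, |s - 1| ≤ 4 * τ ∧ F s = 0 := by
    rcases le_total 0 (F 1) with h | h
    · rw [abs_of_nonneg h] at hF1
      obtain ⟨s, hs, hs0⟩ := exists_zero_of_lt_deriv (g := fun s => -F (1 + s))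
        (g' := fun s => G (1 + s)) (τ := F 1) (q := 1 / 4) h (by norm_num)
        (fun s => by
          simpa using! ((hFG (1 + s)).comp_const_add 1 s).neg)
        (fun s hs hFs => by
          refine hlow _ (by linarith [hs.1]) (by linarith [hs.2]) (abs_le.2 ⟨?_, ?_⟩) <;>
          linarith [hFs.1, hFs.2])
        (by simp)
      refine ⟨1 + s, ?_, by simpa using hs0⟩
      rw [add_sub_cancel_left, abs_of_nonneg hs.1]
      linarith [hs.2]
    · rw [abs_of_nonpos h] at hF1
      obtain ⟨s, hs, hs0⟩ := exists_zero_of_lt_deriv (g := fun s => F (1 - s))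
        (g' := fun s => G (1 - s)) (τ := -F 1) (q := 1 / 4) (by linarith) (by norm_num)
        (fun s => by
          simpa using (hFG (1 - s)).comp_const_sub 1 s)
        (fun s hs hFs => by
          refine hlow _ (by linarith [hs.2]) (by linarith [hs.1]) (abs_le.2 ⟨?_, ?_⟩) <;>
          linarith [hFs.1, hFs.2])
        (by simp)
      refine ⟨1 - s, ?_, by simpa using hs0⟩
      rw [sub_sub_cancel_left, abs_neg, abs_of_nonneg hs.1]
      linarith [hs.2]
  refine ⟨c + s • w, hs0, ?_⟩
  have hd : x - (c + s • w) = (1 - s) • w := by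
    rw [sub_smul, one_smul, hw]; abel
  rw [dist_eq_norm, hd, norm_smul, Real.norm_eq_abs, abs_sub_comm]
  exact mul_le_mul_of_nonneg_right hs (norm_nonneg _)

theorem five_eighths_lt_sigmoid_one : 5 / 8 < Real.sigmoid 1 := by
  have h1 : (2 : ℝ) ≤ Real.exp 1 := by linarith [Real.add_one_le_exp (1 : ℝ)]
  have h2 : Real.exp (-1) ≤ 1 / 2 := by
    rw [Real.exp_neg, one_div]
    exact inv_anti₀ two_pos h1
  rw [Real.sigmoid_def, ← one_div, lt_div_iff₀ (by positivity)]
  linarith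

theorem IsDirectionNet.norm_sub_le_of_score (hu : IsDirectionNet ρ u) (hρ : 0 ≤ ρ)
    (hρ1 : ρ ≤ 1) (hr : 0 < r) (hK : 1 ≤ κ * r)
    (hx : -(1 / 8) ≤ score κ u (fun l => inner ℝ (u l) c + r) x) : ‖x - c‖ ≤ 4 * r := by
  have hκ : 0 < κ := pos_of_mul_pos_left (by linarith) hr.le
  have h2 : ‖x - c‖ ≤ (1 + ρ) * (2 * r) := by
    refine hu.norm_sub_le hρ fun l => ?_
    rw [score_eq] at hx
    have h3 := Finset.single_le_sum
      (f := fun l => Real.sigmoid (κ * (inner ℝ (u l) x - (inner ℝ (u l) c + r))))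
      (fun _ _ => Real.sigmoid_nonneg _) (Finset.mem_univ l)
    have h4 : κ * (inner ℝ (u l) x - (inner ℝ (u l) c + r)) < 1 :=
      Real.sigmoid_lt_iff.1 (lt_of_le_of_lt (by linarith) five_eighths_lt_sigmoid_one)
    have h5 := lt_of_mul_lt_mul_left (h4.trans_le hK) hκ.le
    linarith
  nlinarith

/-- The score is nonnegative at the centre and nonpositive at the points of a sphere that encloses
the polytope, so it vanishes somewhere between. -/
theorem IsDirectionNet.exists_score_eq_zero (hd : 0 < d) (hu : IsDirectionNet ρ u) (hρ : 0 ≤ ρ)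
    (hr : 0 < r) (hκ : 0 < κ) (hc : 0 ≤ score κ u (fun l => inner ℝ (u l) c + r) c) :
    ∃ x, score κ u (fun l => inner ℝ (u l) c + r) x = 0 := by
  have : Nontrivial (EuclideanSpace ℝ (Fin d)) :=
    Module.nontrivial_of_finrank_pos (R := ℝ) (by rwa [finrank_euclideanSpace_fin])
  obtain ⟨w, hw⟩ := exists_norm_eq (EuclideanSpace ℝ (Fin d))
    (show 0 ≤ (1 + ρ) * r by positivity)
  obtain ⟨l, hl⟩ := hu w
  have hl : r ≤ inner ℝ (u l) w := by
    rw [hw] at hl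
    exact le_of_mul_le_mul_left hl (by positivity)
  have hout : score κ u (fun l => inner ℝ (u l) c + r) (c + (1 : ℝ) • w) ≤ 0 := by
    rw [score_add_smul]
    have h1 := Finset.single_le_sum
      (f := fun l => Real.sigmoid (κ * (1 * inner ℝ (u l) w - r)))
      (fun _ _ => Real.sigmoid_nonneg _) (Finset.mem_univ l)
    have h2 : Real.sigmoid 0 ≤ Real.sigmoid (κ * (1 * inner ℝ (u l) w - r)) :=
      Real.sigmoid_le (mul_nonneg hκ.le (by linarith))
    rw [Real.sigmoid_zero] at h2
    linarith
  exact mem_range_of_exists_le_of_exists_ge (continuous_score κ u _) ⟨_, hout⟩ ⟨_, hc⟩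

/-- The tube about the zero set is inside the band because the score is Lipschitz, with a
constant proportional to `κ`; the band is inside a tube because the score crosses zero along rays
with a slope bounded below uniformly in `κ`. -/
theorem IsDirectionNet.halfThicknessBetween_ballBand (hd : 0 < d) (hu : IsDirectionNet ρ u)
    (hu1 : ∀ l, ‖u l‖ = 1) (hρ : 0 ≤ ρ) (hρ1 : ρ ≤ 1) (hr : 0 < r) (hκ : 0 < κ)
    (hK : 20 * m ≤ κ * r) (hc : 0 ≤ score κ u (fun l => inner ℝ (u l) c + r) c)
    {δ lam : ℝ} (hδ : 0 < bandConst δ) (hlam : 0 < lam) (hδlam : bandConst δ / lam ≤ 1 / 8) :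
    HalfThicknessBetween {x | score κ u (fun l => inner ℝ (u l) c + r) x = 0}
      (ballBand δ κ lam u fun l => inner ℝ (u l) c + r)
      (bandConst δ / (m * κ) / lam) (16 * r * bandConst δ / lam) := by
  have hm : (1 : ℝ) ≤ m := by
    obtain ⟨l, -⟩ := hu 0
    exact_mod_cast Fin.pos l
  have hm0 : (0 : ℝ) < m := by linarith
  refine ⟨hu.exists_score_eq_zero hd hρ hr hκ hc, fun x hx => ?_, fun x hx => ?_⟩
  · have hcl : IsClosed {x | score κ u (fun l => inner ℝ (u l) c + r) x = 0} :=
      isClosed_eq (continuous_score κ u _) continuous_const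
    rw [hcl.cthickening_eq_biUnion_closedBall (by positivity)] at hx
    obtain ⟨y, hy, hxy⟩ := Set.mem_iUnion₂.1 hx
    have hy : score κ u (fun l => inner ℝ (u l) c + r) y = 0 := hy
    rw [mem_closedBall] at hxy
    have h := abs_score_sub_score_le (h := fun l => inner ℝ (u l) c + r) hu1 hκ.le x y
    rw [hy, sub_zero] at h
    refine h.trans ((mul_le_mul_of_nonneg_left hxy (by positivity)).trans_eq ?_)
    field_simp
  · have hx : |score κ u (fun l => inner ℝ (u l) c + r) x| ≤ bandConst δ / lam := hx
    obtain ⟨y, hy, hxy⟩ := exists_score_eq_zero_of_abs_score_le hK hδlam hx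
    refine mem_cthickening_of_dist_le x y _ _ hy (hxy.trans ?_)
    have h := hu.norm_sub_le_of_score hρ hρ1 hr (κ := κ) (by linarith)
      (abs_le.1 (hx.trans hδlam)).1
    calc 4 * (bandConst δ / lam) * ‖x - c‖ ≤ 4 * (bandConst δ / lam) * (4 * r) := by gcongr
      _ = 16 * r * bandConst δ / lam := by ring

end BallBand

/-! ### Approximation of a compact set -/

theorem exists_finite_cover {X : Type*} [PseudoMetricSpace X] {K : Set X} (hK : IsCompact K)
    {r : ℝ} (hr : 0 < r) :
    ∃ (R : ℕ) (c : Fin R → X), (∀ j, c j ∈ K) ∧ ∀ x ∈ K, ∃ j, dist x (c j) ≤ r := by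
  obtain ⟨S, hS, -, hcov⟩ := exists_separated_net hK hr
  refine ⟨S.card, fun j => S.equivFin.symm j, fun j => hS _ (S.equivFin.symm j).2, fun x hx => ?_⟩
  obtain ⟨y, hy, hxy⟩ := hcov x hx
  exact ⟨S.equivFin ⟨y, hy⟩, by simpa using hxy⟩

section Approximation

variable {d m R : ℕ} {u : Fin m → EuclideanSpace ℝ (Fin d)} {ρ r κ lam η δ εcov : ℝ}
  {c : Fin R → EuclideanSpace ℝ (Fin d)} {C : Set (EuclideanSpace ℝ (Fin d))}

theorem quarter_le_score_center (hη : 0 < η) (hη1 : η < 1) (hm : m * η ≤ 1 / 4) (hκ : 0 < κ)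
    (hκr : bandConst η / κ ≤ r) (c : EuclideanSpace ℝ (Fin d)) :
    1 / 4 ≤ score κ u (fun l => inner ℝ (u l) c + r) c :=
  quarter_le_score hκ hη hη1 hm fun l => by simpa using hκr

/-- The balls have radius at most `εcov / 3` and centres in `C`, so the cover leaves room for the
bands around the polytopes as soon as `c₁ / κ ≤ r`; no limit in the slopes is needed. -/
theorem IsDirectionNet.decisionSet_approx (hu : IsDirectionNet ρ u) (hρ : 0 ≤ ρ) (hρ1 : ρ ≤ 1)
    (hr : 0 < r) (hrcov : 3 * r ≤ εcov) (hCne : C.Nonempty) (hcC : ∀ j, c j ∈ C)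
    (hcov : ∀ x ∈ C, ∃ j, dist x (c j) ≤ r)
    (hη : 0 < η) (hm : m * η ≤ 1 / 4) (hη1 : η ≤ 1 / 4) (hδ : 0 < δ) (hδ1 : δ < 1)
    (hR : R * δ ≤ 1 / 4) (hκ : 0 < κ) (hκr : bandConst η / κ ≤ r) (hlam : 0 < lam)
    (hδlam : bandConst δ / lam ≤ 1 / 4) :
    (decisionSet κ lam (fun _ : Fin R => u) fun j l => inner ℝ (u l) (c j) + r).Nonempty ∧
    IsCompact (decisionSet κ lam (fun _ : Fin R => u) fun j l => inner ℝ (u l) (c j) + r) ∧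
    hausdorffDist (decisionSet κ lam (fun _ : Fin R => u) fun j l => inner ℝ (u l) (c j) + r) C ≤
      εcov + ρ * r := by
  set D := decisionSet κ lam (fun _ : Fin R => u) fun j l => inner ℝ (u l) (c j) + r with hD
  have hcD : ∀ j, c j ∈ D := fun j =>
    mem_decisionSet_of_score_nonneg hlam.le (j := j)
      ((by norm_num : (0 : ℝ) ≤ 1 / 4).trans
        (quarter_le_score_center hη (by linarith) hm hκ hκr (c j)))
  have hDc : ∀ x ∈ D, ∃ j, dist x (c j) ≤ εcov + ρ * r := by
    intro x hx
    obtain ⟨j, hj⟩ := exists_forall_lt_of_mem_decisionSet hη hη1 hδ hδ1 hR hκ hlam hδlam hx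
    refine ⟨j, ?_⟩
    have h := hu.norm_sub_le hρ (x := x) (c := c j) (s := r + bandConst η / κ)
      fun l => by linarith [hj l]
    rw [dist_eq_norm]
    nlinarith
  have hbdd : Bornology.IsBounded D :=
    (Bornology.isBounded_iUnion.2 fun j => isBounded_closedBall
      (x := c j) (r := εcov + ρ * r)).subset fun x hx => Set.mem_iUnion.2 (hDc x hx)
  obtain ⟨x₀, hx₀⟩ := hCne
  obtain ⟨j₀, -⟩ := hcov x₀ hx₀
  have hρr : 0 ≤ ρ * r := by positivity
  refine ⟨⟨c j₀, hcD j₀⟩, isCompact_of_isClosed_isBounded (isClosed_decisionSet _ _ _ _) hbdd,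
    hausdorffDist_le_of_mem_dist (by linarith) (fun x hx => ?_) fun x hx => ?_⟩
  · obtain ⟨j, hj⟩ := hDc x hx
    exact ⟨c j, hcC j, hj⟩
  · obtain ⟨j, hj⟩ := hcov x hx
    exact ⟨c j, hcD j, by linarith⟩

/-- With `κ = c₁ / r` the facet bands swallow the whole polytopes: every point of a polytope lies
at depth at most `r` below one of its facets. -/
theorem IsDirectionNet.iUnion_polytope_subset_innerBand (hu : IsDirectionNet ρ u) (hρ : 0 ≤ ρ)
    (hκr : bandConst η / κ = r) :
    (⋃ j, polytope u fun l => inner ℝ (u l) (c j) + r) ⊆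
      innerBand η κ (fun _ : Fin R => u) fun j l => inner ℝ (u l) (c j) + r := by
  intro x hx
  obtain ⟨j, hj⟩ := Set.mem_iUnion.1 hx
  obtain ⟨l, hl⟩ := hu.exists_le_inner hρ (c j) x
  have hxl : inner ℝ (u l) x ≤ inner ℝ (u l) (c j) + r := hj l
  refine Set.mem_iUnion₂.2 ⟨j, l, ?_⟩
  change |inner ℝ (u l) (c j) + r - inner ℝ (u l) x| ≤ bandConst η / κ
  rw [hκr, abs_of_nonneg (sub_nonneg.2 hxl)]
  linarith

end Approximation

end BallCoverMLP

theorem mainTheorem4 (d : ℕ) (hd : 2 ≤ d) :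
    -- the constants of the rate for the facet counts depend on the dimension only
    ∃ a b : ℝ, 0 < a ∧ 0 < b ∧
    ∀ C : Set (EuclideanSpace ℝ (Fin d)), C.Nonempty → IsCompact C →
    ∀ ε εcov : ℝ, 0 < εcov → εcov < ε →
    -- the finite cover by closed balls
    ∃ (R : ℕ) (c : Fin R → EuclideanSpace ℝ (Fin d)) (r : Fin R → ℝ),
      (∀ j, 0 < r j) ∧
      C ⊆ (⋃ j, Metric.closedBall (c j) (r j)) ∧
      (⋃ j, Metric.closedBall (c j) (r j)) ⊆ Metric.cthickening εcov C ∧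
    ∀ εpoly : ℝ, 0 < εpoly → (∀ j, εpoly ≤ r j) → εcov + εpoly < ε →
    -- the circumscribed polytopes
    ∃ (m : Fin R → ℕ) (u : ∀ j, Fin (m j) → EuclideanSpace ℝ (Fin d))
      (h : ∀ j, Fin (m j) → ℝ),
      (∀ j, BallCoverMLP.IsCircumscribed (c j) (r j) (u j) (h j) ∧
        Metric.hausdorffDist (BallCoverMLP.polytope (u j) (h j))
          (Metric.closedBall (c j) (r j)) ≤ εpoly ∧
        a * (r j / εpoly) ^ (((d : ℝ) - 1) / 2) ≤ (m j : ℝ) ∧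
        (m j : ℝ) ≤ b * (r j / εpoly) ^ (((d : ℝ) - 1) / 2)) ∧
    ∀ η δ : ℝ, 0 < η → (∀ j, η < 1 / (4 * (m j : ℝ))) → 0 < δ → δ ≤ 1 / (4 * (R : ℝ)) →
      -- error bound and band thicknesses, for all sufficiently large slopes
      (∃ κ₀ lam₀ : ℝ, 0 < κ₀ ∧ 0 < lam₀ ∧
        (∀ κ lam : ℝ, κ₀ ≤ κ → lam₀ ≤ lam →
          (BallCoverMLP.decisionSet κ lam u h).Nonempty ∧
          IsCompact (BallCoverMLP.decisionSet κ lam u h) ∧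
          Metric.hausdorffDist (BallCoverMLP.decisionSet κ lam u h) C ≤
            εcov + εpoly + BallCoverMLP.bandConst η / κ + BallCoverMLP.bandConst δ / lam ∧
          εcov + εpoly + BallCoverMLP.bandConst η / κ + BallCoverMLP.bandConst δ / lam ≤ ε) ∧
        (∃ A₁ B₁ : ℝ, 0 < A₁ ∧ 0 < B₁ ∧ ∀ κ : ℝ, κ₀ ≤ κ → ∀ j, ∀ l : Fin (m j),
          BallCoverMLP.HalfThicknessBetween {x | inner ℝ (u j l) x = h j l}
            (BallCoverMLP.facetBand η κ (u j l) (h j l)) (A₁ / κ) (B₁ / κ)) ∧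
        (∃ B₂ : ℝ, 0 < B₂ ∧ ∀ κ : ℝ, κ₀ ≤ κ → ∃ A₂ : ℝ, 0 < A₂ ∧ ∀ lam : ℝ, lam₀ ≤ lam → ∀ j,
          BallCoverMLP.HalfThicknessBetween {x | BallCoverMLP.score κ (u j) (h j) x = 0}
            (BallCoverMLP.ballBand δ κ lam (u j) (h j)) (A₂ / lam) (B₂ / lam))) ∧
      -- pointwise agreement off the bands, for all slopes
      (∀ κ lam : ℝ, 0 < κ → 0 < lam → ∀ x : EuclideanSpace ℝ (Fin d),
        x ∉ BallCoverMLP.innerBand η κ u h → x ∉ BallCoverMLP.outerBand δ κ lam u h →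
        (x ∈ BallCoverMLP.decisionSet κ lam u h ↔
          x ∈ ⋃ j, BallCoverMLP.polytope (u j) (h j)) ∧
        ((x ∈ C ∨ εcov + εpoly < Metric.infDist x C) →
          (x ∈ BallCoverMLP.decisionSet κ lam u h ↔ x ∈ C))) ∧
      -- slopes with the error bound and agreement with `C` itself off the bands
      (∃ κ lam : ℝ, 0 < κ ∧ 0 < lam ∧
        (BallCoverMLP.decisionSet κ lam u h).Nonempty ∧
        IsCompact (BallCoverMLP.decisionSet κ lam u h) ∧
        Metric.hausdorffDist (BallCoverMLP.decisionSet κ lam u h) C ≤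
          εcov + εpoly + BallCoverMLP.bandConst η / κ + BallCoverMLP.bandConst δ / lam ∧
        εcov + εpoly + BallCoverMLP.bandConst η / κ + BallCoverMLP.bandConst δ / lam ≤ ε ∧
        ∀ x : EuclideanSpace ℝ (Fin d),
          x ∉ BallCoverMLP.innerBand η κ u h → x ∉ BallCoverMLP.outerBand δ κ lam u h →
          (x ∈ BallCoverMLP.decisionSet κ lam u h ↔ x ∈ C)) := by
  have hd0 : (0 : ℝ) < d := by exact_mod_cast (show 0 < d by omega)
  refine ⟨d / 2 ^ d, (3 ^ d + d) * 2 ^ d, by positivity, by positivity, ?_⟩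
  intro C hCne hCc ε εcov hεcov hε
  obtain ⟨r, hr, hrcov, hrε⟩ : ∃ r : ℝ, 0 < r ∧ 3 * r ≤ εcov ∧ 3 * r ≤ ε - εcov := by
    refine ⟨min (εcov / 3) ((ε - εcov) / 3), lt_min (by linarith) (by linarith), ?_, ?_⟩
    · linarith [min_le_left (εcov / 3) ((ε - εcov) / 3)]
    · linarith [min_le_right (εcov / 3) ((ε - εcov) / 3)]
  obtain ⟨R, c, hcC, hcov⟩ := BallCoverMLP.exists_finite_cover hCc hr
  refine ⟨R, c, fun _ => r, fun _ => hr, fun x hx => Set.mem_iUnion.2 (hcov x hx),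
    Set.iUnion_subset fun j x hx => Metric.mem_cthickening_of_dist_le x (c j) _ _ (hcC j)
      ((Metric.mem_closedBall.1 hx).trans (by linarith)), ?_⟩
  intro εpoly hεpoly hεr _
  obtain ⟨x₀, hx₀⟩ := id hCne
  obtain ⟨j₀, -⟩ := hcov x₀ hx₀
  replace hεr : εpoly ≤ r := hεr j₀
  obtain ⟨ρ, hρ, hρ1, hρr, hρinv⟩ : ∃ ρ : ℝ, 0 < ρ ∧ ρ ≤ 1 ∧ ρ * r = εpoly ∧ 1 / ρ = r / εpoly :=
    ⟨εpoly / r, by positivity, (div_le_one hr).2 hεr, div_mul_cancel₀ _ hr.ne', one_div_div _ _⟩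
  obtain ⟨m, u, hu1, hinj, hu, hmlow, hmup⟩ := BallCoverMLP.exists_normals hd hρ hρ1
  rw [hρinv] at hmlow hmup
  have hm1 : (1 : ℝ) ≤ m := by
    obtain ⟨l, -⟩ := hu 0
    exact_mod_cast Fin.pos l
  have hm0 : (0 : ℝ) < m := by linarith
  have hR1 : (1 : ℝ) ≤ R := by exact_mod_cast Fin.pos j₀
  refine ⟨fun _ => m, fun _ => u, fun j l => inner ℝ (u l) (c j) + r,
    fun j => ⟨hu.isCircumscribed hρ.le hu1 hinj,
      hρr ▸ hu.hausdorffDist_polytope_le hρ.le hu1 hr, hmlow, hmup⟩, ?_⟩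
  intro η δ hη hηm hδ hδR
  have hmη : m * η ≤ 1 / 4 := by
    have h := hηm j₀
    rw [lt_div_iff₀ (by positivity)] at h
    linarith
  have hη1 : η ≤ 1 / 4 := by nlinarith
  have hRδ : R * δ ≤ 1 / 4 := by
    rw [le_div_iff₀ (by positivity)] at hδR
    linarith
  have hδ1 : δ ≤ 1 / 4 := by nlinarith
  have hc₁ := BallCoverMLP.bandConst_pos hη (by linarith)
  have hc₂ := BallCoverMLP.bandConst_pos hδ (by linarith)
  set c₁ := BallCoverMLP.bandConst η with hc₁def
  set c₂ := BallCoverMLP.bandConst δ with hc₂def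
  have hκ₁ : 0 < c₁ / r := by positivity
  have hlam₁ : 0 < max (8 * c₂) (c₂ / r) := lt_max_of_lt_left (by positivity)
  have hκle : ∀ κ, c₁ / r ≤ κ → c₁ / κ ≤ r := fun κ h =>
    (div_le_comm₀ hr (hκ₁.trans_le h)).1 h
  have hlamle : ∀ lam, max (8 * c₂) (c₂ / r) ≤ lam → c₂ / lam ≤ 1 / 8 ∧ c₂ / lam ≤ r := by
    intro lam h
    have hlam := hlam₁.trans_le h
    refine ⟨?_, (div_le_comm₀ hr hlam).1 ((le_max_right _ _).trans h)⟩
    rw [div_le_iff₀ hlam]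
    linarith [(le_max_left _ _).trans h]
  have happrox : ∀ κ lam : ℝ, c₁ / r ≤ κ → max (8 * c₂) (c₂ / r) ≤ lam →
      (BallCoverMLP.decisionSet κ lam (fun _ : Fin R => u)
        fun j l => inner ℝ (u l) (c j) + r).Nonempty ∧
      IsCompact (BallCoverMLP.decisionSet κ lam (fun _ : Fin R => u)
        fun j l => inner ℝ (u l) (c j) + r) ∧
      Metric.hausdorffDist (BallCoverMLP.decisionSet κ lam (fun _ : Fin R => u)
        fun j l => inner ℝ (u l) (c j) + r) C ≤ εcov + εpoly + c₁ / κ + c₂ / lam ∧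
      εcov + εpoly + c₁ / κ + c₂ / lam ≤ ε := by
    intro κ lam hκ hlam
    have hκ0 := hκ₁.trans_le hκ
    have hlam0 := hlam₁.trans_le hlam
    have hκr := hκle κ hκ
    obtain ⟨hlam8, hlamr⟩ := hlamle lam hlam
    obtain ⟨hne, hcomp, hdist⟩ := hu.decisionSet_approx hρ.le hρ1 hr hrcov hCne hcC hcov hη hmη
      hη1 hδ (by linarith) hRδ hκ0 hκr hlam0 (hlam8.trans (by norm_num))
    have h1 : 0 < c₁ / κ := by positivity
    have h2 : 0 < c₂ / lam := by positivity
    rw [hρr] at hdist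
    exact ⟨hne, hcomp, by linarith, by linarith⟩
  have hpoly : ∀ x ∈ ⋃ j, BallCoverMLP.polytope u (fun l => inner ℝ (u l) (c j) + r),
      Metric.infDist x C ≤ εcov + εpoly := by
    intro x hx
    obtain ⟨j, hj⟩ := Set.mem_iUnion.1 hx
    have h := Metric.mem_closedBall.1 (hu.polytope_subset hρ.le hj)
    rw [one_add_mul, hρr] at h
    linarith [Metric.infDist_le_dist_of_mem (x := x) (hcC j)]
  have hCpoly : C ⊆ ⋃ j, BallCoverMLP.polytope u (fun l => inner ℝ (u l) (c j) + r) :=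
    fun x hx => by
      obtain ⟨j, hj⟩ := hcov x hx
      exact Set.mem_iUnion.2 ⟨j, BallCoverMLP.closedBall_subset_polytope hu1 hj⟩
  have hoff : ∀ κ lam : ℝ, 0 < κ → 0 < lam → ∀ x : EuclideanSpace ℝ (Fin d),
      x ∉ BallCoverMLP.innerBand η κ (fun _ : Fin R => u)
        (fun j l => inner ℝ (u l) (c j) + r) →
      x ∉ BallCoverMLP.outerBand δ κ lam (fun _ : Fin R => u)
        (fun j l => inner ℝ (u l) (c j) + r) →
      (x ∈ BallCoverMLP.decisionSet κ lam (fun _ : Fin R => u)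
        (fun j l => inner ℝ (u l) (c j) + r) ↔
        x ∈ ⋃ j, BallCoverMLP.polytope u (fun l => inner ℝ (u l) (c j) + r)) :=
    fun κ lam hκ hlam x hin hout =>
      BallCoverMLP.mem_decisionSet_iff_of_notMem_bands hη (by linarith) (fun _ => hmη) hδ
        (by linarith) hRδ hκ hlam hin hout
  refine ⟨⟨max (c₁ / r) (20 * m / r), max (8 * c₂) (c₂ / r), lt_max_of_lt_left hκ₁, hlam₁,
    fun κ lam hκ hlam => happrox κ lam ((le_max_left _ _).trans hκ) hlam,
    ⟨c₁, c₁, hc₁, hc₁, fun κ hκ j l => ?_⟩,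
    ⟨16 * r * c₂, by positivity, fun κ hκ => ?_⟩⟩, ?_, ?_⟩
  · have hκ0 : 0 < κ := hκ₁.trans_le ((le_max_left _ _).trans hκ)
    exact BallCoverMLP.halfThicknessBetween_facetBand (hu1 l) (by positivity)
  · have hκ' := (le_max_left _ _).trans hκ
    have hκ0 : 0 < κ := hκ₁.trans_le hκ'
    have hK : 20 * m ≤ κ * r := (div_le_iff₀ hr).1 ((le_max_right _ _).trans hκ)
    refine ⟨c₂ / (m * κ), by positivity, fun lam hlam j => ?_⟩
    exact hu.halfThicknessBetween_ballBand (by omega) hu1 hρ.le hρ1 hr hκ0 hK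
      ((by norm_num : (0 : ℝ) ≤ 1 / 4).trans
        (BallCoverMLP.quarter_le_score_center hη (by linarith) hmη hκ0 (hκle κ hκ') (c j)))
      hc₂ (hlam₁.trans_le hlam) (hlamle lam hlam).1
  · intro κ lam hκ hlam x hin hout
    have h := hoff κ lam hκ hlam x hin hout
    refine ⟨h, fun hx => h.trans ?_⟩
    rcases hx with hx | hx
    · exact ⟨fun _ => hx, fun hx => hCpoly hx⟩
    · exact ⟨fun hxP => absurd (hpoly x hxP) (not_le.2 hx), fun hxC => hCpoly hxC⟩
  · obtain ⟨hne, hcomp, hdist, hle⟩ := happrox (c₁ / r) _ le_rfl le_rfl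
    refine ⟨c₁ / r, max (8 * c₂) (c₂ / r), hκ₁, hlam₁, hne, hcomp, hdist, hle, ?_⟩
    intro x hin hout
    -- At this slope the inner band contains all the polytopes, hence also `C`.
    have hx : x ∉ ⋃ j, BallCoverMLP.polytope u (fun l => inner ℝ (u l) (c j) + r) := fun hx =>
      hin (hu.iUnion_polytope_subset_innerBand hρ.le (div_div_cancel₀ hc₁.ne') hx)
    exact (hoff _ _ hκ₁ hlam₁ x hin hout).trans
      ⟨fun h => absurd h hx, fun h => absurd (hCpoly h) hx⟩
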